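/- Let $c>1$ be a real number that is not an integer and let $m\ge 2$ be an integer. Consider the sequence $a(n)=\lfloor n^c\rfloor \bmod m$, $n=0,1,2,\dots$, with values in $\{0,1,\dots,m-1\}$. Then, for every positive integer $H$, at least $H^2/4$ distinct words of length $H$ occur in $a$, that is, $$\bigl|\{(a(n),a(n+1),\dots,a(n+H-1)) : n\ge 0\}\bigr| \ge \frac{H^2}{4}.$$ Moreover, the sequence $a$ is not automatic: there is no integer $k\ge 2$ for which some finite deterministic automaton with output, reading the base-$k$ expansion of $n$ starting with the most significant digit, outputs $a(n)$ for every $n\ge 0$. -/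

import Mathlib

/-- The set of words of length `H` that occur in the sequence `a` as contiguous blocks
`(a n, a (n + 1), …, a (n + H - 1))`, `n ≥ 0`. -/
def wordsOfLength {A : Type*} (a : ℕ → A) (H : ℕ) : Set (Fin H → A) :=
  Set.range fun n : ℕ => fun h : Fin H => a (n + h)

/-- The subword complexity `N_H(a)` of a sequence `a` that takes finitely many values:
the number of distinct words of length `H` that occur in `a`. -/
noncomputable def subwordComplexity {A : Type*} (a : ℕ → A) (H : ℕ) : ℕ :=
  (wordsOfLength a H).ncard

/-- A deterministic automaton with output: input alphabet `α`, states `σ`, outputs in `A`. -/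
structure DFAO (α σ A : Type*) where
  /-- The transition function: from every state there is one edge for each letter. -/
  step : σ → α → σ
  /-- The initial state. -/
  start : σ
  /-- The output attached to each state. -/
  output : σ → A

/-- The output of the automaton after reading the word `w` from left to right. -/
def DFAO.run {α σ A : Type*} (M : DFAO α σ A) (w : List α) : A :=
  M.output (w.foldl M.step M.start)

/-- The base-`k` expansion of `n` without leading zeros, most significant digit first
(the expansion of `0` is the empty word). -/
def baseExpansion (k : ℕ) (hk : 2 ≤ k) (n : ℕ) : List (Fin k) :=
  (Nat.digits k n).reverse.pmap (fun d hd => ⟨d, hd⟩)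
    fun _ hd => Nat.digits_lt_base hk (List.mem_reverse.mp hd)

/-- The sequence `a` is `k`-automatic: some finite automaton with output that reads the base-`k`
expansion of `n`, most significant digit first, outputs `a n`, for every `n`. -/
def IsKAutomatic {A : Type*} (k : ℕ) (hk : 2 ≤ k) (a : ℕ → A) : Prop :=
  ∃ (σ : Type) (_ : Finite σ) (M : DFAO (Fin k) σ A), ∀ n : ℕ, a n = M.run (baseExpansion k hk n)

/-- The sequence `a` is automatic: it is `k`-automatic for some base `k ≥ 2`. -/
def IsAutomatic {A : Type*} (a : ℕ → A) : Prop :=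
  ∃ (k : ℕ) (hk : 2 ≤ k), IsKAutomatic k hk a

/-- The sequence `n ↦ ⌊n ^ c⌋ mod m`, with values in `{0, 1, …, m - 1}` for `m ≥ 1`. -/
noncomputable def floorPowMod (c : ℝ) (m : ℕ) (n : ℕ) : ℤ :=
  ⌊(n : ℝ) ^ c⌋ % (m : ℤ)

/-! The words `h ↦ ⌊(h + r) / j⌋ mod m` all occur: it suffices that `n ^ c / m` minus an affine
function of slope `1 / (j * m)` stays near `0` modulo one along a long block. For non-integral `c`,
the difference of order `⌊c⌋` of such a function tends to infinity with steps tending to zero, so it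
lingers in every interval modulo one. `DwellsModOne.of_fwdDiff` carries this back to the function
itself: a difference that is small and positive modulo one makes the function climb slowly. About `H
^ 2 / 4` of these words are told apart by their first two jumps. An automatic sequence has only
`O(H)` words of length `H = k ^ s`, since two consecutive automaton states and an offset determine
such a word. -/

open Filter Topology fwdDiff

/-! ### Dwelling modulo one -/

/-- For every interval `[a, b]` there are arbitrarily long blocks of consecutive natural numbers
on which `F` stays in `[a, b]` modulo one. -/
def DwellsModOne (F : ℝ → ℝ) : Prop :=
  ∀ a b : ℝ, a < b → ∀ L : ℕ, ∃ N : ℕ, ∀ n ≤ L, ∃ z : ℤ,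
    a ≤ F ((N : ℝ) + n) - z ∧ F ((N : ℝ) + n) - z ≤ b

theorem abs_sub_le_mul_of_abs_step_le {u : ℕ → ℝ} {η : ℝ} {M n : ℕ}
    (hu : ∀ i < M, |u (i + 1) - u i| ≤ η) (t : ℕ) (ht : n + t ≤ M) :
    |u (n + t) - u n| ≤ η * t := by
  induction t with
  | zero => simp
  | succ t ih =>
    have h1 := ih (by omega)
    have h2 := hu (n + t) (by omega)
    rw [← add_assoc]
    push_cast
    rw [abs_le] at *
    constructor <;> linarith

/-- A sequence with small steps that climbs by at least one dwells in `[a, b]` modulo one. -/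
theorem exists_dwell_of_small_steps {u : ℕ → ℝ} {η a b : ℝ} {K L : ℕ}
    (hu : ∀ i < K + L, |u (i + 1) - u i| ≤ η) (hK : u 0 + 1 ≤ u K) (hη : 0 ≤ η)
    (hL : η * (L + 1) ≤ (b - a) / 2) :
    ∃ n ≤ K, ∃ z : ℤ, ∀ t ≤ L, a ≤ u (n + t) - z ∧ u (n + t) - z ≤ b := by
  classical
  -- The lifted midpoint `z + (a + b) / 2` lies in `[u 0, u 0 + 1)`. At its first crossing `u`
  -- overshoots by at most `η`, then drifts by at most `η * L`, within the half-length of `[a, b]`.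
  set z : ℤ := ⌈u 0 - (a + b) / 2⌉ with hz
  have hz1 : u 0 - (a + b) / 2 ≤ z := Int.le_ceil _
  have hz2 : (z : ℝ) < u 0 - (a + b) / 2 + 1 := Int.ceil_lt_add_one _
  have hex : ∃ n, (z : ℝ) + (a + b) / 2 ≤ u n := ⟨K, by linarith⟩
  have hnK : Nat.find hex ≤ K := Nat.find_min' hex (by linarith)
  have hn := Nat.find_spec hex
  have hup : u (Nat.find hex) ≤ z + (a + b) / 2 + η := by
    rcases Nat.eq_zero_or_pos (Nat.find hex) with h0 | hpos
    · rw [h0]; linarith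
    · obtain ⟨k, hk⟩ : ∃ k, Nat.find hex = k + 1 := ⟨_, (Nat.succ_pred_eq_of_pos hpos).symm⟩
      have h1 := not_le.1 (Nat.find_min hex (show k < Nat.find hex by omega))
      have h2 := (abs_le.1 (hu k (by omega))).2
      rw [hk]
      linarith
  refine ⟨Nat.find hex, hnK, z, fun t ht => ?_⟩
  have h := abs_le.1 (abs_sub_le_mul_of_abs_step_le (n := Nat.find hex) hu t (by omega))
  have ht' : η * t ≤ η * L := mul_le_mul_of_nonneg_left (by exact_mod_cast ht) hη
  constructor <;> linarith

/-- Make the difference dwell in `[θ, 2θ]` modulo one. Subtracting partial sums of the integer parts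
leaves `F` unchanged modulo one and gives a sequence with steps in `[θ, 2θ]`; after `K ≥ 1 / θ`
steps it has climbed by at least one. -/
theorem DwellsModOne.of_fwdDiff {F : ℝ → ℝ} (h : DwellsModOne (Δ_[(1 : ℝ)] F)) :
    DwellsModOne F := by
  intro a b hab L
  set θ : ℝ := (b - a) / (4 * (L + 1)) with hθ
  have hL0 : (0 : ℝ) < L + 1 := by positivity
  have hθ0 : 0 < θ := by have := sub_pos.2 hab; positivity
  set K : ℕ := ⌈1 / θ⌉₊ with hK
  have hKθ : 1 ≤ K * θ := by
    rw [← div_le_iff₀ hθ0]; exact Nat.le_ceil _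
  obtain ⟨N, hN⟩ := h θ (2 * θ) (by linarith) (K + L)
  choose! z hz using hN
  set u : ℕ → ℝ := fun n => F ((N : ℝ) + n) - ((∑ i ∈ Finset.range n, z i : ℤ) : ℝ) with hu
  have hstep : ∀ i ≤ K + L, θ ≤ u (i + 1) - u i ∧ u (i + 1) - u i ≤ 2 * θ := by
    intro i hi
    have := hz i hi
    have e : u (i + 1) - u i = fwdDiff (1 : ℝ) F ((N : ℝ) + i) - z i := by
      simp only [hu, fwdDiff, Finset.sum_range_succ]
      push_cast
      rw [add_assoc (N : ℝ)]
      ring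
    rwa [e]
  have hlow : ∀ n ≤ K, u 0 + n * θ ≤ u n := by
    intro n
    induction n with
    | zero => simp
    | succ n ih =>
      intro hn
      have h1 := ih (by omega)
      have h2 := (hstep n (by omega)).1
      push_cast
      linarith
  obtain ⟨n, hn, w, hw⟩ := exists_dwell_of_small_steps (u := u) (η := 2 * θ) (a := a) (b := b)
    (K := K) (L := L)
    (fun i hi => by
      have := hstep i hi.le
      rw [abs_le]; constructor <;> linarith)
    (by linarith [hlow K le_rfl]) (by linarith)
    (by rw [hθ]; field_simp; linarith)
  refine ⟨N + n, fun t ht => ⟨(∑ i ∈ Finset.range (n + t), z i) + w, ?_⟩⟩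
  have := hw t ht
  simp only [hu] at this
  push_cast at this ⊢
  rw [← add_assoc] at this
  constructor <;> linarith

theorem DwellsModOne.of_fwdDiff_iter {F : ℝ → ℝ} (k : ℕ)
    (h : DwellsModOne (Δ_[(1 : ℝ)] ^[k] F)) : DwellsModOne F := by
  induction k generalizing F with
  | zero => exact h
  | succ k ih => exact (ih h).of_fwdDiff

theorem dwellsModOne_of_tendsto {F : ℝ → ℝ} (hF : Tendsto F atTop atTop)
    (hd : Tendsto (Δ_[(1 : ℝ)] F) atTop (𝓝 0)) : DwellsModOne F := by
  intro a b hab L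
  set η : ℝ := (b - a) / (2 * (L + 1)) with hη
  have hL0 : (0 : ℝ) < L + 1 := by positivity
  have hη0 : 0 < η := by have := sub_pos.2 hab; positivity
  obtain ⟨x₀, hx₀⟩ := eventually_atTop.1 (Metric.tendsto_nhds.1 hd η hη0)
  obtain ⟨N, hN⟩ := exists_nat_ge x₀
  have hshift : Tendsto (fun n : ℕ => F ((N : ℝ) + n)) atTop atTop :=
    hF.comp (tendsto_atTop_add_const_left _ _ tendsto_natCast_atTop_atTop)
  obtain ⟨K, hK⟩ := (hshift.eventually_ge_atTop (F N + 1)).exists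
  obtain ⟨n, hn, z, hz⟩ := exists_dwell_of_small_steps (u := fun n : ℕ => F ((N : ℝ) + n))
    (η := η) (a := a) (b := b) (K := K) (L := L)
    (fun i _ => by
      have h := hx₀ ((N : ℝ) + i) (by have : (0 : ℝ) ≤ i := by positivity
                                      linarith)
      rw [Real.dist_eq, sub_zero] at h
      push_cast
      rw [← add_assoc]
      exact h.le)
    (by simpa using hK) hη0.le (by rw [hη]; field_simp; norm_num)
  refine ⟨N + n, fun t ht => ⟨z, ?_⟩⟩
  have := hz t ht
  push_cast at this ⊢
  rwa [← add_assoc] at this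

/-- The blocks in `DwellsModOne` may be required to start at a multiple of `q`. -/
theorem DwellsModOne.exists_mul {F : ℝ → ℝ} (h : DwellsModOne F) {q : ℕ} (hq : 0 < q)
    {a b : ℝ} (hab : a < b) (L : ℕ) :
    ∃ N : ℕ, ∀ n ≤ L, ∃ z : ℤ,
      a ≤ F ((q * N : ℕ) + n) - z ∧ F ((q * N : ℕ) + n) - z ≤ b := by
  obtain ⟨N, hN⟩ := h a b hab (L + q)
  have hle : N ≤ q * (N / q + 1) := by
    have := Nat.div_add_mod N q; have := Nat.mod_lt N hq; rw [mul_add]; omega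
  have hle' : q * (N / q + 1) ≤ N + q := by
    have := Nat.mul_div_le N q; rw [mul_add]; omega
  obtain ⟨s, hs⟩ := Nat.exists_eq_add_of_le hle
  refine ⟨N / q + 1, fun n hn => ?_⟩
  obtain ⟨z, hz⟩ := hN (s + n) (by omega)
  refine ⟨z, ?_⟩
  rw [hs]
  push_cast at hz ⊢
  rwa [← add_assoc] at hz

/-! ### Iterated differences of powers -/

theorem hasDerivAt_fwdDiff_iter {f f' : ℝ → ℝ} (h : ∀ x > 0, HasDerivAt f (f' x) x) (k : ℕ) :
    ∀ x > 0, HasDerivAt (Δ_[(1 : ℝ)] ^[k] f) (Δ_[(1 : ℝ)] ^[k] f' x) x := by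
  induction k generalizing f f' with
  | zero => exact h
  | succ k ih =>
    refine ih (f := Δ_[(1 : ℝ)] f) (f' := Δ_[(1 : ℝ)] f') fun x hx => ?_
    exact ((h (x + 1) (by linarith)).comp_add_const x 1).sub (h x hx)

/-- The `(k + 1)`-st difference of `x ^ c` is a multiple of the `k`-th difference of `x ^ (c - 1)`
at an intermediate point. -/
theorem fwdDiff_iter_succ_rpow (c : ℝ) (k : ℕ) {x : ℝ} (hx : 0 < x) :
    ∃ y, x ≤ y ∧ Δ_[(1 : ℝ)] ^[k + 1] (fun x : ℝ => x ^ c) x =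
      c * Δ_[(1 : ℝ)] ^[k] (fun x : ℝ => x ^ (c - 1)) y := by
  have hd := hasDerivAt_fwdDiff_iter (f := fun x : ℝ => x ^ c)
    (f' := c • fun x : ℝ => x ^ (c - 1))
    (fun x hx => Real.hasDerivAt_rpow_const (Or.inl (ne_of_gt hx))) k
  obtain ⟨y, hy, hy'⟩ := exists_hasDerivAt_eq_slope _ _ (lt_add_one x)
    (fun y hy => (hd y (by linarith [hy.1])).continuousAt.continuousWithinAt)
    (fun y hy => hd y (by linarith [hy.1]))
  refine ⟨y, hy.1.le, ?_⟩
  rw [fwdDiff_iter_const_smul] at hy'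
  rw [Function.iterate_succ_apply']
  simpa [fwdDiff] using hy'.symm

/-- The intermediate point is at least `x`, hence tends to infinity; one difference thus trades for
lowering the exponent by one. -/
theorem tendsto_fwdDiff_iter_rpow {l : Filter ℝ} {k : ℕ} {c : ℝ}
    (h : Tendsto (fun y => c * Δ_[(1 : ℝ)] ^[k] (fun x : ℝ => x ^ (c - 1)) y) atTop l) :
    Tendsto (Δ_[(1 : ℝ)] ^[k + 1] (fun x : ℝ => x ^ c)) atTop l := by
  choose! y hy using fun x (hx : (0 : ℝ) < x) => fwdDiff_iter_succ_rpow c k hx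
  have hytop : Tendsto y atTop atTop := by
    refine tendsto_atTop_mono' atTop ?_ tendsto_id
    filter_upwards [eventually_gt_atTop 0] with x hx using (hy x hx).1
  refine (h.comp hytop).congr' ?_
  filter_upwards [eventually_gt_atTop 0] with x hx using (hy x hx).2.symm

theorem tendsto_fwdDiff_iter_rpow_atTop (k : ℕ) {c : ℝ} (hc : (k : ℝ) < c) :
    Tendsto (Δ_[(1 : ℝ)] ^[k] (fun x : ℝ => x ^ c)) atTop atTop := by
  induction k generalizing c with
  | zero => exact tendsto_rpow_atTop (by simpa using hc)
  | succ k ih =>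
    push_cast at hc
    exact tendsto_fwdDiff_iter_rpow ((ih (by linarith)).const_mul_atTop
      (lt_of_le_of_lt (by positivity) hc))

theorem tendsto_fwdDiff_iter_rpow_zero (k : ℕ) {c : ℝ} (hc : c < k) :
    Tendsto (Δ_[(1 : ℝ)] ^[k] (fun x : ℝ => x ^ c)) atTop (𝓝 0) := by
  induction k generalizing c with
  | zero =>
    have := tendsto_rpow_neg_atTop (y := -c) (by simpa using hc)
    simpa using this
  | succ k ih =>
    push_cast at hc
    refine tendsto_fwdDiff_iter_rpow ?_
    simpa using (ih (show c - 1 < k by linarith)).const_mul c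

theorem fwdDiff_iter_affine (s t : ℝ) (k : ℕ) :
    ∃ C : ℝ, Δ_[(1 : ℝ)] ^[k + 1] (fun x : ℝ => s * x + t) = fun _ => C := by
  induction k with
  | zero => exact ⟨s, by ext x; simp [fwdDiff]; ring⟩
  | succ k ih =>
    obtain ⟨C, hC⟩ := ih
    refine ⟨0, ?_⟩
    rw [Function.iterate_succ_apply', hC]
    ext x; simp [fwdDiff]

/-- A non-integral power plus an affine function dwells everywhere modulo one. -/
theorem dwellsModOne_rpow_add_affine {c : ℝ} (hc : 1 < c) (hc_int : ∀ z : ℤ, c ≠ (z : ℝ))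
    {g : ℝ} (hg : 0 < g) (s t : ℝ) : DwellsModOne (fun x => g * x ^ c + (s * x + t)) := by
  -- The order `d + 1 = ⌊c⌋` is at least one, so the affine part becomes a constant.
  obtain ⟨d, hd⟩ : ∃ d : ℕ, ⌊c⌋₊ = d + 1 :=
    ⟨⌊c⌋₊ - 1, (Nat.sub_add_cancel (Nat.one_le_floor_iff c |>.2 hc.le)).symm⟩
  have h1 : ((d + 1 : ℕ) : ℝ) < c := by
    refine lt_of_le_of_ne (hd ▸ Nat.floor_le (by linarith)) fun h => hc_int (d + 1 : ℕ) ?_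
    rw [← h]; simp
  have h2 : c < ((d + 2 : ℕ) : ℝ) := by
    have := Nat.lt_floor_add_one c
    rw [hd] at this
    push_cast at this ⊢
    linarith
  obtain ⟨C, hC⟩ := fwdDiff_iter_affine s t d
  have hF : (fun x : ℝ => g * x ^ c + (s * x + t)) =
      g • (fun x : ℝ => x ^ c) + fun x => s * x + t := rfl
  have key : Δ_[(1 : ℝ)] ^[d + 1] (fun x : ℝ => g * x ^ c + (s * x + t)) =
      fun x => g * Δ_[(1 : ℝ)] ^[d + 1] (fun x : ℝ => x ^ c) x + C := by
    rw [hF, fwdDiff_iter_add, fwdDiff_iter_const_smul, hC]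
    rfl
  refine DwellsModOne.of_fwdDiff_iter (d + 1) ?_
  rw [key]
  refine dwellsModOne_of_tendsto ?_ ?_
  · exact tendsto_atTop_add_const_right _ _
      ((tendsto_fwdDiff_iter_rpow_atTop (d + 1) h1).const_mul_atTop hg)
  · have h := (tendsto_fwdDiff_iter_rpow_zero (d + 2) h2).const_mul g
    rw [mul_zero] at h
    refine h.congr fun x => ?_
    rw [Function.iterate_succ_apply']
    simp only [fwdDiff]
    ring

/-! ### Words that occur, and their number -/

theorem mem_wordsOfLength_floorPowMod {c : ℝ} (hc : 1 < c) (hc_int : ∀ z : ℤ, c ≠ (z : ℝ))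
    {m : ℕ} (hm : 0 < m) {j : ℕ} (hj : 0 < j) (r H : ℕ) :
    (fun h : Fin H => (((h + r) / j : ℕ) : ℤ) % (m : ℤ)) ∈
      wordsOfLength (floorPowMod c m) H := by
  have hmR : (0 : ℝ) < m := by exact_mod_cast hm
  have hjR : (0 : ℝ) < j := by exact_mod_cast hj
  -- The shift `1 / 2` and tolerance `1 / 4` keep `n ^ c`, modulo `m`, strictly between consecutive
  -- multiples of `1 / j`. Starting at a multiple of `j * m` makes the linear term an integer there.
  obtain ⟨N, hN⟩ := (dwellsModOne_rpow_add_affine hc hc_int (g := 1 / m) (by positivity)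
    (-(1 / (j * m))) (-((r + 1 / 2) / (j * m)))).exists_mul (q := j * m) (Nat.mul_pos hj hm)
    (a := -(1 / 4 / (j * m))) (b := 1 / 4 / (j * m))
    (by have : 0 < 1 / 4 / ((j : ℝ) * m) := by positivity
        linarith) H
  refine ⟨j * m * N, funext fun h => ?_⟩
  obtain ⟨z, hz1, hz2⟩ := hN h h.2.le
  have hdiv : (j : ℝ) * ((h + r) / j : ℕ) + ((h + r) % j : ℕ) = h + r := by
    exact_mod_cast Nat.div_add_mod (h + r) j
  have hmod : (((h + r) % j : ℕ) : ℝ) + 1 ≤ j := by exact_mod_cast Nat.mod_lt (h + r) hj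
  have hmod0 : (0 : ℝ) ≤ ((h + r) % j : ℕ) := by positivity
  have hfloor : ⌊((j * m * N + h : ℕ) : ℝ) ^ c⌋ = m * (z + N) + ((h + r) / j : ℕ) := by
    set p : ℕ := (h + r) / j
    push_cast at hz1 hz2
    rw [Int.floor_eq_iff]
    push_cast
    set X : ℝ := ((j : ℝ) * m * N + (h : ℕ)) ^ c
    have e : j * m * (1 / m * X + (-(1 / (j * m)) * ((j : ℝ) * m * N + (h : ℕ)) +
        -((r + 1 / 2) / (j * m))) - z) = j * (X - m * (z + N)) - (h + r + 1 / 2) := by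
      field_simp
      ring
    have hjm : (0 : ℝ) ≤ j * m := by positivity
    have h1 := mul_le_mul_of_nonneg_left hz1 hjm
    have h2 := mul_le_mul_of_nonneg_left hz2 hjm
    have e4 : (j : ℝ) * m * (1 / 4 / (j * m)) = 1 / 4 := by field_simp
    rw [e, mul_neg, e4] at h1
    rw [e, e4] at h2
    constructor
    · have : j * (p : ℝ) ≤ j * (X - m * (z + N)) := by linarith
      linarith [le_of_mul_le_mul_left this hjR]
    · have : j * (X - m * (z + N)) < j * ((p : ℝ) + 1) := by linarith
      linarith [lt_of_mul_lt_mul_left this hjR.le]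
  simp only [floorPowMod, hfloor]
  rw [add_comm, Int.add_mul_emod_self_left]

theorem finite_wordsOfLength_floorPowMod (c : ℝ) {m : ℕ} (hm : 0 < m) (H : ℕ) :
    (wordsOfLength (floorPowMod c m) H).Finite := by
  refine (Set.Finite.pi' fun _ : Fin H => Set.finite_Ico (0 : ℤ) m).subset ?_
  rintro _ ⟨n, rfl⟩ h
  have hm' : (0 : ℤ) < m := by exact_mod_cast hm
  exact ⟨Int.emod_nonneg _ hm'.ne', Int.emod_lt_of_pos _ hm'⟩

/-- The words `h ↦ ⌊(h + j - i) / j⌋` taken modulo `m` have their first two jumps at `i` and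
`i + j`; these pairs `(i, j)` are told apart by a word of length `H`. -/
def jumpPairs (H : ℕ) : Finset (ℕ × ℕ) :=
  (Finset.Icc 1 H ×ˢ Finset.Icc 1 H).filter fun p =>
    p.1 ≤ p.2 ∧ (p.1 + p.2 < H ∨ p.2 = H)

theorem mem_jumpPairs {H : ℕ} {p : ℕ × ℕ} :
    p ∈ jumpPairs H ↔ 1 ≤ p.1 ∧ p.1 ≤ p.2 ∧ p.2 ≤ H ∧ (p.1 + p.2 < H ∨ p.2 = H) := by
  simp only [jumpPairs, Finset.mem_filter, Finset.mem_product, Finset.mem_Icc]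
  omega

theorem sum_range_sub_two_mul (H K : ℕ) (hK : 2 * K ≤ H + 1) :
    ∑ i ∈ Finset.range K, (H - 2 * i) + K * K = K * (H + 1) := by
  induction K with
  | zero => simp
  | succ K ih =>
    rw [Finset.sum_range_succ]
    have := ih (by omega)
    have h2 : H - 2 * K + 2 * K = H := by omega
    nlinarith

theorem sq_le_four_mul_card_jumpPairs (H : ℕ) : H ^ 2 ≤ 4 * (jumpPairs H).card := by
  have hcard : ((Finset.range ((H + 1) / 2)).sigma fun i => Finset.range (H - 2 * i)).card ≤
      (jumpPairs H).card := by
    -- Row `0` lists the `H` pairs with `j = H`; row `i ≥ 1` lists the `H - 2 * i` values `i ≤ j < H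
    -- - i`.
    refine Finset.card_le_card_of_injOn
      (fun p => if p.1 = 0 then (p.2 + 1, H) else (p.1, p.1 + p.2)) ?_ ?_
    · rintro ⟨i, t⟩ hp
      simp only [Finset.coe_sigma, Set.mem_sigma_iff, Finset.coe_range, Set.mem_Iio] at hp
      rw [Finset.mem_coe, mem_jumpPairs]
      dsimp only
      split_ifs <;> dsimp only <;> omega
    · rintro ⟨i, t⟩ hp ⟨i', t'⟩ hp' h
      simp only [Finset.coe_sigma, Set.mem_sigma_iff, Finset.coe_range, Set.mem_Iio] at hp hp'
      dsimp only at h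
      have : i = i' ∧ t = t' := by
        split_ifs at h <;> simp only [Prod.mk.injEq] at h <;> omega
      obtain ⟨rfl, rfl⟩ := this
      rfl
  rw [Finset.card_sigma] at hcard
  simp only [Finset.card_range] at hcard
  have hs := sum_range_sub_two_mul H ((H + 1) / 2) (by omega)
  obtain ⟨K, hK⟩ : ∃ K, (H + 1) / 2 = K := ⟨_, rfl⟩
  rw [hK] at hs hcard
  obtain h | h : H = 2 * K ∨ H + 1 = 2 * K := by omega
  · subst h; nlinarith
  · nlinarith

/-- If `i < i'`, the words read `1` and `0` at position `i`. If `i = i'` and `j < j'`, then `j ≠ H`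
puts `i + j` inside the word, where they read `2` and `1` modulo `m`. -/
theorem injOn_jump_words {m : ℕ} (hm : 2 ≤ m) (H : ℕ) :
    Set.InjOn (fun p : ℕ × ℕ => fun h : Fin H =>
      (((h + (p.2 - p.1)) / p.2 : ℕ) : ℤ) % (m : ℤ)) (jumpPairs H) := by
  have key : ∀ p ∈ jumpPairs H, ∀ p' ∈ jumpPairs H, (∀ h < H,
      (h + (p.2 - p.1)) / p.2 % m = (h + (p'.2 - p'.1)) / p'.2 % m) →
      ¬ (p.1 < p'.1 ∨ p.1 = p'.1 ∧ p.2 < p'.2) := by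
    rintro ⟨i, j⟩ hp ⟨i', j'⟩ hp' h hlt
    rw [mem_jumpPairs] at hp hp'
    dsimp only at hp hp' h hlt
    rcases hlt with hlt | ⟨rfl, hlt⟩
    · have h1 := h i (by omega)
      rw [Nat.div_eq_of_lt (show i + (j' - i') < j' by omega),
        show i + (j - i) = j by omega, Nat.div_self (by omega), Nat.zero_mod,
        Nat.mod_eq_of_lt (by omega)] at h1
      omega
    · have h1 := h (i + j) (by omega)
      rw [show i + j + (j - i) = j * 2 by omega, Nat.mul_div_cancel_left _ (by omega),
        show i + j + (j' - i) = j + j' by omega, Nat.add_div_right _ (by omega),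
        Nat.div_eq_of_lt hlt] at h1
      have h2 : 1 ≡ 2 [MOD m] := h1.symm
      have := Nat.le_of_dvd (by omega) ((Nat.modEq_iff_dvd' (by omega)).1 h2)
      omega
  rintro p hp p' hp' h
  have h' : ∀ h < H, (h + (p.2 - p.1)) / p.2 % m = (h + (p'.2 - p'.1)) / p'.2 % m :=
    fun n hn => by
      have := congrFun h ⟨n, hn⟩
      dsimp only at this
      exact_mod_cast this
  have h1 := key p hp p' hp' h'
  have h2 := key p' hp' p hp fun n hn => (h' n hn).symm
  ext <;> omega

theorem sq_div_four_le_subwordComplexity {c : ℝ} (hc : 1 < c) (hc_int : ∀ z : ℤ, c ≠ (z : ℝ))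
    {m : ℕ} (hm : 2 ≤ m) (H : ℕ) :
    (H : ℝ) ^ 2 / 4 ≤ (subwordComplexity (floorPowMod c m) H : ℝ) := by
  have hle : (jumpPairs H).card ≤ subwordComplexity (floorPowMod c m) H := by
    rw [← Set.ncard_coe_finset]
    refine Set.ncard_le_ncard_of_injOn _ (fun p hp => ?_) (injOn_jump_words hm H)
      (finite_wordsOfLength_floorPowMod c (by omega) H)
    have := mem_jumpPairs.1 hp
    exact mem_wordsOfLength_floorPowMod hc hc_int (by omega) (by omega) _ H
  have h4 : (H : ℝ) ^ 2 ≤ 4 * (jumpPairs H).card := by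
    exact_mod_cast sq_le_four_mul_card_jumpPairs H
  have : ((jumpPairs H).card : ℝ) ≤ subwordComplexity (floorPowMod c m) H := by
    exact_mod_cast hle
  linarith

/-! ### Automatic sequences have few words -/

/-- The state reached by an automaton after reading the base-`k` expansion of `n`. -/
def DFAO.state {σ A : Type*} {k : ℕ} (M : DFAO (Fin k) σ A) (hk : 2 ≤ k) (n : ℕ) : σ :=
  (baseExpansion k hk n).foldl M.step M.start

theorem baseExpansion_mul_add {k : ℕ} (hk : 2 ≤ k) (q : ℕ) (e : Fin k) (h : q ≠ 0) :
    baseExpansion k hk (k * q + e) = baseExpansion k hk q ++ [e] := by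
  have hd : Nat.digits k (k * q + e) = (e : ℕ) :: Nat.digits k q := by
    rw [add_comm]
    exact Nat.digits_add k (by omega) e q e.2 (Or.inr h)
  apply List.map_injective_iff.2 Fin.val_injective
  simp [baseExpansion, List.map_pmap, hd]

theorem DFAO.state_mul_add {σ A : Type*} {k : ℕ} (M : DFAO (Fin k) σ A) (hk : 2 ≤ k) {q : ℕ}
    (h : q ≠ 0) (e : Fin k) : M.state hk (k * q + e) = M.step (M.state hk q) e := by
  simp [DFAO.state, baseExpansion_mul_add hk q e h]

theorem DFAO.state_pow_mul_add_congr {σ A : Type*} {k : ℕ} (M : DFAO (Fin k) σ A) (hk : 2 ≤ k)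
    {q q' : ℕ} (hq : q ≠ 0) (hq' : q' ≠ 0) (h : M.state hk q = M.state hk q') (s : ℕ) :
    ∀ r < k ^ s, M.state hk (k ^ s * q + r) = M.state hk (k ^ s * q' + r) := by
  induction s with
  | zero =>
    intro r hr
    obtain rfl : r = 0 := by simpa using hr
    simpa using h
  | succ s ih =>
    intro r hr
    have e : ∀ q, k ^ (s + 1) * q + r = k * (k ^ s * q + r / k) + r % k := fun q => by
      rw [mul_add, add_assoc, Nat.div_add_mod]; ring
    have hne : ∀ q, q ≠ 0 → k ^ s * q + r / k ≠ 0 := fun q hq => by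
      have : 0 < k ^ s * q := by positivity
      exact (Nat.add_pos_left this _).ne'
    have hlt : r % k < k := Nat.mod_lt _ (by omega)
    have h1 := ih (r / k) (Nat.div_lt_of_lt_mul (by rwa [pow_succ'] at hr))
    rw [e, e, M.state_mul_add hk (hne q hq) ⟨_, hlt⟩, M.state_mul_add hk (hne q' hq') ⟨_, hlt⟩, h1]

/-- The words of length `k ^ s` in a `k`-automatic sequence number at most `C * k ^ s`. -/
theorem IsKAutomatic.exists_subwordComplexity_le {A : Type*} {k : ℕ} {hk : 2 ≤ k} {a : ℕ → A}
    (h : IsKAutomatic k hk a) : ∃ C : ℕ, ∀ s, subwordComplexity a (k ^ s) ≤ C * k ^ s := by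
  classical
  obtain ⟨σ, _, M, hM⟩ := h
  refine ⟨Nat.card (Option σ) * Nat.card (Option σ), fun s => ?_⟩
  have hpos : 0 < k ^ s := by positivity
  -- Block `0` needs its own label `none`: without leading zeros, its expansions do not extend a
  -- common prefix of full-length digits.
  let κ : ℕ → Option σ := fun q => if q = 0 then none else some (M.state hk q)
  have hκ : ∀ q q' r, κ q = κ q' → r < k ^ s → a (k ^ s * q + r) = a (k ^ s * q' + r) := by
    intro q q' r h hr
    by_cases hq : q = 0 <;> by_cases hq' : q' = 0 <;> simp only [κ, hq, hq', if_true, if_false,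
      reduceCtorEq, Option.some.injEq] at h ⊢
    rw [hM, hM]
    exact congrArg M.output (M.state_pow_mul_add_congr hk hq hq' h s r hr)
  let f : ℕ → Option σ × Option σ × Fin (k ^ s) := fun n =>
    (κ (n / k ^ s), κ (n / k ^ s + 1), ⟨n % k ^ s, Nat.mod_lt _ hpos⟩)
  let w : ℕ → Fin (k ^ s) → A := fun n h => a (n + h)
  have hfac : w.FactorsThrough f := by
    intro n n' hn
    simp only [f, Prod.mk.injEq, Fin.mk.injEq] at hn
    obtain ⟨h1, h2, h3⟩ := hn
    funext h
    have hh := h.2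
    have hlt := Nat.mod_lt n hpos
    have e := Nat.div_add_mod n (k ^ s)
    have e' := Nat.div_add_mod n' (k ^ s)
    rw [← h3] at e'
    change a (n + h) = a (n' + h)
    by_cases hcase : n % k ^ s + h < k ^ s
    · have := hκ _ _ _ h1 hcase
      rwa [← add_assoc, ← add_assoc, e, e'] at this
    · have := hκ _ _ (n % k ^ s + h - k ^ s) h2 (by omega)
      rw [mul_add, mul_add, mul_one] at this
      convert this using 2 <;> omega
  have : Nonempty (Fin (k ^ s) → A) := ⟨w 0⟩
  obtain ⟨g, hg⟩ := (Function.factorsThrough_iff w).1 hfac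
  calc subwordComplexity a (k ^ s) = (Set.range w).ncard := rfl
    _ ≤ (g '' Set.univ).ncard := by
        rw [hg, Set.image_univ]
        exact Set.ncard_le_ncard (Set.range_comp_subset_range _ _) (Set.finite_range g)
    _ ≤ (Set.univ : Set (Option σ × Option σ × Fin (k ^ s))).ncard := Set.ncard_image_le
    _ = Nat.card (Option σ) * Nat.card (Option σ) * k ^ s := by
        rw [Set.ncard_univ, Nat.card_prod, Nat.card_prod, Nat.card_fin, mul_assoc]

theorem not_isAutomatic_of_sq_div_four_le {A : Type*} {a : ℕ → A}
    (h : ∀ H : ℕ, 0 < H → (H : ℝ) ^ 2 / 4 ≤ (subwordComplexity a H : ℝ)) : ¬ IsAutomatic a := by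
  rintro ⟨k, hk, ha⟩
  -- At `H = k ^ (4 * C) > 4 * C` the quadratic lower bound exceeds `C * H`.
  obtain ⟨C, hC⟩ := ha.exists_subwordComplexity_le
  have hpos : 0 < k ^ (4 * C) := by positivity
  have h1 := h _ hpos
  have h2 : (subwordComplexity a (k ^ (4 * C)) : ℝ) ≤ C * (k ^ (4 * C) : ℕ) := by
    exact_mod_cast hC (4 * C)
  have h3 : (4 * C : ℝ) < (k ^ (4 * C) : ℕ) := by
    exact_mod_cast Nat.lt_pow_self (n := 4 * C) (by omega : 1 < k)
  have hposR : (0 : ℝ) < (k ^ (4 * C) : ℕ) := by exact_mod_cast hpos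
  nlinarith

theorem mainTheorem6 (c : ℝ) (hc : 1 < c) (hc_int : ∀ z : ℤ, c ≠ (z : ℝ))
    (m : ℕ) (hm : 2 ≤ m) :
    (∀ H : ℕ, 0 < H → (H : ℝ) ^ 2 / 4 ≤ (subwordComplexity (floorPowMod c m) H : ℝ)) ∧
      ¬ IsAutomatic (floorPowMod c m) := by
  have h : ∀ H : ℕ, 0 < H →
      (H : ℝ) ^ 2 / 4 ≤ (subwordComplexity (floorPowMod c m) H : ℝ) :=
    fun H _ => sq_div_four_le_subwordComplexity hc hc_int hm H
  exact ⟨h, not_isAutomatic_of_sq_div_four_le h⟩
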